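/- Formulas are built from propositional variables $p_0,p_1,\dots$ with $\wedge,\vee,\to,\bot,\top$ (and $\neg\varphi:=\varphi\to\bot$). The implication depth $d$ is given by $d(p)=d(\bot)=d(\top)=0$, $d(\varphi\wedge\psi)=d(\varphi\vee\psi)=\max(d(\varphi),d(\psi))$ and $d(\varphi\to\psi)=\max(d(\varphi),d(\psi))+1$. A superintuitionistic logic is a set of formulas that contains intuitionistic propositional logic $\mathsf{IPC}$ and is closed under modus ponens and uniform substitution; $L\oplus\alpha$ denotes the least superintuitionistic logic that contains $L$ and the formula $\alpha$. A superintuitionistic logic $L$ is uniformly locally tabular if there is an $n\in\mathbb{N}$ such that for every formula $\varphi$ there is a formula $\psi$ with $d(\psi)\le n$ and $(\varphi\to\psi)\wedge(\psi\to\varphi)\in L$. It is pre-uniformly locally tabular if it is not uniformly locally tabular, but every superintuitionistic logic $L'\supsetneq L$ is. Let $$\mathsf{wPL}=\mathsf{IPC}\oplus (q\to p)\vee\bigl(((p\to q)\to p)\to p\bigr),\qquad \mathsf{bw}_2=\bigvee_{i=0}^{2}\Bigl(p_i\to\bigvee_{j\in\{0,1,2\}\setminus\{i\}}p_j\Bigr),$$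 $$\mathsf{Box}=\mathsf{wPL}\oplus\mathsf{bw}_2\oplus(\neg p\vee\neg\neg p).$$ **Corollary.** The logic $\mathsf{Box}$ is pre-uniformly locally tabular: $\mathsf{Box}$ is not uniformly locally tabular, but every superintuitionistic logic properly extending $\mathsf{Box}$ is uniformly locally tabular. -/

import Mathlib

/-- Formulas of the language of Heyting algebras over the propositional variables `p_0, p_1, …`. -/
inductive Formula : Type
  | var : ℕ → Formula
  | bot : Formula
  | top : Formula
  | and : Formula → Formula → Formula
  | or : Formula → Formula → Formula
  | imp : Formula → Formula → Formula

namespace Formula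

infixr:55 " ⇒ₚ " => Formula.imp
infixl:65 " ∨ₚ " => Formula.or
infixl:70 " ∧ₚ " => Formula.and

/-- Negation `¬φ` abbreviates `φ → ⊥`. -/
def neg (φ : Formula) : Formula := φ ⇒ₚ bot

/-- `φ ↔ ψ` abbreviates `(φ → ψ) ∧ (ψ → φ)`. -/
def iff (φ ψ : Formula) : Formula := (φ ⇒ₚ ψ) ∧ₚ (ψ ⇒ₚ φ)

/-- Implication depth. -/
def depth : Formula → ℕ
  | var _ => 0
  | bot => 0
  | top => 0
  | and φ ψ => max φ.depth ψ.depth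
  | or φ ψ => max φ.depth ψ.depth
  | imp φ ψ => max φ.depth ψ.depth + 1

/-- Uniform substitution. -/
def subst (σ : ℕ → Formula) : Formula → Formula
  | var i => σ i
  | bot => bot
  | top => top
  | and φ ψ => and (φ.subst σ) (ψ.subst σ)
  | or φ ψ => or (φ.subst σ) (ψ.subst σ)
  | imp φ ψ => imp (φ.subst σ) (ψ.subst σ)

end Formula

/-- Derivability in the Hilbert calculus of intuitionistic propositional logic. -/
inductive IPCProvable : Formula → Prop
  | k (φ ψ : Formula) : IPCProvable (φ ⇒ₚ ψ ⇒ₚ φ)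
  | s (φ ψ χ : Formula) : IPCProvable ((φ ⇒ₚ ψ ⇒ₚ χ) ⇒ₚ (φ ⇒ₚ ψ) ⇒ₚ φ ⇒ₚ χ)
  | andLeft (φ ψ : Formula) : IPCProvable (φ ∧ₚ ψ ⇒ₚ φ)
  | andRight (φ ψ : Formula) : IPCProvable (φ ∧ₚ ψ ⇒ₚ ψ)
  | andIntro (φ ψ : Formula) : IPCProvable (φ ⇒ₚ ψ ⇒ₚ φ ∧ₚ ψ)
  | orLeft (φ ψ : Formula) : IPCProvable (φ ⇒ₚ φ ∨ₚ ψ)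
  | orRight (φ ψ : Formula) : IPCProvable (ψ ⇒ₚ φ ∨ₚ ψ)
  | orElim (φ ψ χ : Formula) : IPCProvable ((φ ⇒ₚ χ) ⇒ₚ (ψ ⇒ₚ χ) ⇒ₚ φ ∨ₚ ψ ⇒ₚ χ)
  | exFalso (φ : Formula) : IPCProvable (Formula.bot ⇒ₚ φ)
  | topIntro : IPCProvable Formula.top
  | mp {φ ψ : Formula} : IPCProvable (φ ⇒ₚ ψ) → IPCProvable φ → IPCProvable ψ

theorem IPCProvable.subst (σ : ℕ → Formula) {φ : Formula} (h : IPCProvable φ) :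
    IPCProvable (φ.subst σ) := by
  induction h with
  | k φ ψ => exact .k _ _
  | s φ ψ χ => exact .s _ _ _
  | andLeft φ ψ => exact .andLeft _ _
  | andRight φ ψ => exact .andRight _ _
  | andIntro φ ψ => exact .andIntro _ _
  | orLeft φ ψ => exact .orLeft _ _
  | orRight φ ψ => exact .orRight _ _
  | orElim φ ψ χ => exact .orElim _ _ _
  | exFalso φ => exact .exFalso _
  | topIntro => exact .topIntro
  | mp _ _ ih₁ ih₂ => exact .mp ih₁ ih₂

/-- A superintuitionistic logic: a set of formulas that contains intuitionistic logic and is closed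
under modus ponens and uniform substitution. (The set of all formulas is one of them.) -/
structure SILogic where
  carrier : Set Formula
  ipc_mem : ∀ φ, IPCProvable φ → φ ∈ carrier
  mp_mem : ∀ φ ψ, (φ ⇒ₚ ψ) ∈ carrier → φ ∈ carrier → ψ ∈ carrier
  subst_mem : ∀ (σ : ℕ → Formula) (φ), φ ∈ carrier → φ.subst σ ∈ carrier

namespace SILogic

/-- Intuitionistic propositional logic. -/
def IPC : SILogic where
  carrier := {φ | IPCProvable φ}
  ipc_mem _ h := h
  mp_mem _ _ h₁ h₂ := IPCProvable.mp h₁ h₂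
  subst_mem σ _ h := IPCProvable.subst σ h

/-- `L ⊕ α`: the least superintuitionistic logic that contains `L` and the formula `α`. -/
def adjoin (L : SILogic) (α : Formula) : SILogic where
  carrier := {φ | ∀ L' : SILogic, L.carrier ⊆ L'.carrier → α ∈ L'.carrier → φ ∈ L'.carrier}
  ipc_mem φ h L' _ _ := L'.ipc_mem φ h
  mp_mem φ ψ h₁ h₂ L' hL hα := L'.mp_mem φ ψ (h₁ L' hL hα) (h₂ L' hL hα)
  subst_mem σ φ h L' hL hα := L'.subst_mem σ φ (h L' hL hα)

/-- `L` is `n`-uniform: every formula is equivalent over `L` to one of implication depth at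
most `n`. -/
def IsNUniform (n : ℕ) (L : SILogic) : Prop :=
  ∀ φ : Formula, ∃ ψ : Formula, ψ.depth ≤ n ∧ Formula.iff φ ψ ∈ L.carrier

/-- Uniform local tabularity: `n`-uniform for some `n`. -/
def IsUniformlyLocallyTabular (L : SILogic) : Prop :=
  ∃ n : ℕ, L.IsNUniform n

/-- Pre-uniform local tabularity: not uniformly locally tabular, but every proper extension is. -/
def IsPreUniformlyLocallyTabular (L : SILogic) : Prop :=
  ¬ L.IsUniformlyLocallyTabular ∧
    ∀ L' : SILogic, L.carrier ⊂ L'.carrier → L'.IsUniformlyLocallyTabular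

/-- The weak Peirce law `(q → p) ∨ (((p → q) → p) → p)`, with `p = p_0` and `q = p_1`. -/
def weakPeirce : Formula :=
  (.var 1 ⇒ₚ .var 0) ∨ₚ (((.var 0 ⇒ₚ .var 1) ⇒ₚ .var 0) ⇒ₚ .var 0)

/-- The bounded width axiom `bw₂`, the disjunction over `i ≤ 2` of
`p_i → ⋁_{j ≠ i} p_j`. -/
def bw₂ : Formula :=
  (.var 0 ⇒ₚ .var 1 ∨ₚ .var 2) ∨ₚ (.var 1 ⇒ₚ .var 0 ∨ₚ .var 2) ∨ₚ
    (.var 2 ⇒ₚ .var 0 ∨ₚ .var 1)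

/-- The weak excluded middle `¬p ∨ ¬¬p`. -/
def weakExcludedMiddle : Formula :=
  (Formula.var 0).neg ∨ₚ (Formula.var 0).neg.neg

/-- The logic `wPL = IPC ⊕ (q → p) ∨ (((p → q) → p) → p)`. -/
def wPL : SILogic := IPC.adjoin weakPeirce

/-- The logic `Box = wPL ⊕ bw₂ ⊕ ¬p ∨ ¬¬p`. -/
def Box : SILogic := (wPL.adjoin bw₂).adjoin weakExcludedMiddle

end SILogic

/-! `Box` turns out to be the logic of a single frame, the infinite ladder. Above a prime theory
containing `Box`, weak Peirce makes incomparable points have the same strict successors, `bw₂`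
leaves each point at most one incomparable partner, and weak excluded middle gives upper bounds.

Failure of uniformity: under `indexVal`, `node i true` and `node (i + 1) false` satisfy the same
variables, and separating them takes implication depth that grows with `i` (`forces_indexVal_iff`,
`forces_separator`).

Extensions: if `L ⊇ Box` is not uniformly locally tabular, then for every `n` some two distinct
points above a prime theory of `L` agree up to depth `n`
(`isUniformlyLocallyTabular_of_locally_separated`). Incomparable points differ on a variable, so
these two are comparable, and unwinding their agreement produces `n + 1` stacked antichains
(`exists_isStack`). Substitutions let the stack simulate every ladder valuation down to its lowest
layer, so `L` is valid on the ladder (`subset_logicOf_ladder`). Conversely, a non-theorem of `Box`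
fails at a prime theory with finitely many points above it, and these are the image of an upper part
of the ladder (`logicOf_subset_box`). Hence `L ⊆ Box`, and `L` is not a proper extension. -/

/-! ### Kripke semantics -/

/-- Forcing at the points of a preordered set, for the valuation `V`. -/
def Forces {W : Type*} [Preorder W] (V : ℕ → W → Prop) : W → Formula → Prop
  | w, .var i => V i w
  | _, .bot => False
  | _, .top => True
  | w, .and φ ψ => Forces V w φ ∧ Forces V w ψ
  | w, .or φ ψ => Forces V w φ ∨ Forces V w ψ
  | w, .imp φ ψ => ∀ u, w ≤ u → Forces V u φ → Forces V u ψ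

/-- Valuations whose values are upper sets. -/
def Persistent {W : Type*} [Preorder W] (V : ℕ → W → Prop) : Prop :=
  ∀ i w u, w ≤ u → V i w → V i u

section Semantics

variable {W : Type*} [Preorder W] {V : ℕ → W → Prop}

theorem Forces.mono (hV : Persistent V) {φ : Formula} {w u : W} (h : w ≤ u)
    (hw : Forces V w φ) : Forces V u φ := by
  induction φ with
  | var i => exact hV i w u h hw
  | bot => exact hw
  | top => trivial
  | and φ ψ ih₁ ih₂ => exact ⟨ih₁ hw.1, ih₂ hw.2⟩
  | or φ ψ ih₁ ih₂ => exact hw.imp ih₁ ih₂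
  | imp φ ψ => exact fun v hv => hw v (h.trans hv)

theorem IPCProvable.forces (hV : Persistent V) {φ : Formula} (h : IPCProvable φ) (w : W) :
    Forces V w φ := by
  induction h generalizing w with
  | k φ ψ => exact fun u _ hu v hv _ => hu.mono hV hv
  | s φ ψ χ =>
    exact fun u _ hu v hv hv' x hx hx' => hu x (hv.trans hx) hx' x le_rfl (hv' x hx hx')
  | andLeft φ ψ => exact fun u _ hu => hu.1
  | andRight φ ψ => exact fun u _ hu => hu.2
  | andIntro φ ψ => exact fun u _ hu v hv hv' => ⟨hu.mono hV hv, hv'⟩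
  | orLeft φ ψ => exact fun u _ hu => Or.inl hu
  | orRight φ ψ => exact fun u _ hu => Or.inr hu
  | orElim φ ψ χ =>
    exact fun u _ hu v hv hv' x hx hx' =>
      hx'.elim (hu x (hv.trans hx)) (hv' x hx)
  | exFalso φ => exact fun u _ hu => hu.elim
  | topIntro => trivial
  | mp _ _ ih₁ ih₂ => exact ih₁ w w le_rfl (ih₂ w)

theorem forces_subst (σ : ℕ → Formula) (φ : Formula) (w : W) :
    Forces V w (φ.subst σ) ↔ Forces (fun i u => Forces V u (σ i)) w φ := by
  induction φ generalizing w with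
  | var i => rfl
  | bot => rfl
  | top => rfl
  | and φ ψ ih₁ ih₂ => exact and_congr (ih₁ w) (ih₂ w)
  | or φ ψ ih₁ ih₂ => exact or_congr (ih₁ w) (ih₂ w)
  | imp φ ψ ih₁ ih₂ =>
    exact forall_congr' fun u => imp_congr_right fun _ => imp_congr (ih₁ u) (ih₂ u)

/-- Related points of a bisimulation force the same formulas. -/
theorem forces_iff_of_bisimulation {W' : Type*} [Preorder W'] {V' : ℕ → W' → Prop}
    (R : W → W' → Prop) (hvar : ∀ w w', R w w' → ∀ i, V i w ↔ V' i w')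
    (forth : ∀ w w', R w w' → ∀ u, w ≤ u → ∃ u', w' ≤ u' ∧ R u u')
    (back : ∀ w w', R w w' → ∀ u', w' ≤ u' → ∃ u, w ≤ u ∧ R u u')
    (φ : Formula) {w : W} {w' : W'} (h : R w w') : Forces V w φ ↔ Forces V' w' φ := by
  induction φ generalizing w w' with
  | var i => exact hvar w w' h i
  | bot => rfl
  | top => rfl
  | and φ ψ ih₁ ih₂ => exact and_congr (ih₁ h) (ih₂ h)
  | or φ ψ ih₁ ih₂ => exact or_congr (ih₁ h) (ih₂ h)
  | imp φ ψ ih₁ ih₂ =>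
    constructor
    · intro H u' hu' hφ
      obtain ⟨u, hu, hR⟩ := back w w' h u' hu'
      exact (ih₂ hR).1 (H u hu ((ih₁ hR).2 hφ))
    · intro H u hu hφ
      obtain ⟨u', hu', hR⟩ := forth w w' h u hu
      exact (ih₂ hR).2 (H u' hu' ((ih₁ hR).1 hφ))

end Semantics

/-- The superintuitionistic logic of a Kripke frame. -/
def logicOf (W : Type*) [Preorder W] : SILogic where
  carrier := {φ | ∀ V : ℕ → W → Prop, Persistent V → ∀ w, Forces V w φ}
  ipc_mem _ h _ hV w := h.forces hV w
  mp_mem _ _ h₁ h₂ _ hV w := h₁ _ hV w w le_rfl (h₂ _ hV w)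
  subst_mem σ φ h _ hV w :=
    (forces_subst σ φ w).2 (h _ (fun _ _ _ hu hw => hw.mono hV hu) w)

namespace SILogic

theorem subset_adjoin (L : SILogic) (α : Formula) : L.carrier ⊆ (L.adjoin α).carrier :=
  fun _ h _ hL _ => hL h

theorem mem_adjoin (L : SILogic) (α : Formula) : α ∈ (L.adjoin α).carrier :=
  fun _ _ hα => hα

theorem adjoin_subset {L L' : SILogic} {α : Formula} (hL : L.carrier ⊆ L'.carrier)
    (hα : α ∈ L'.carrier) : (L.adjoin α).carrier ⊆ L'.carrier :=
  fun _ h => h L' hL hα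

theorem box_subset {L : SILogic} (h₁ : weakPeirce ∈ L.carrier) (h₂ : bw₂ ∈ L.carrier)
    (h₃ : weakExcludedMiddle ∈ L.carrier) : Box.carrier ⊆ L.carrier :=
  adjoin_subset (adjoin_subset (adjoin_subset (fun φ h => L.ipc_mem φ h) h₁) h₂) h₃

theorem weakPeirce_mem_box : weakPeirce ∈ Box.carrier :=
  subset_adjoin _ _ (subset_adjoin _ _ (mem_adjoin _ _))

theorem bw₂_mem_box : bw₂ ∈ Box.carrier :=
  subset_adjoin _ _ (mem_adjoin _ _)

theorem weakExcludedMiddle_mem_box : weakExcludedMiddle ∈ Box.carrier :=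
  mem_adjoin _ _

end SILogic

/-! ### The infinite ladder -/

/-- The linear sum of a top element and, below it, infinitely many antichains of size two. -/
inductive Ladder : Type
  | top : Ladder
  | node : ℕ → Bool → Ladder

namespace Ladder

/-- The distance from the top. -/
def level : Ladder → ℕ
  | top => 0
  | node i _ => i + 1

instance : PartialOrder Ladder where
  le d e := d = e ∨ e.level < d.level
  le_refl _ := Or.inl rfl
  le_trans a b c := by
    rintro (rfl | h₁) (rfl | h₂)
    · exact Or.inl rfl
    · exact Or.inr h₂
    · exact Or.inr h₁
    · exact Or.inr (h₂.trans h₁)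
  le_antisymm a b := by
    rintro (rfl | h₁) (h | h₂)
    · rfl
    · rfl
    · exact h.symm
    · exact absurd h₁ h₂.asymm

theorem le_def {d e : Ladder} : d ≤ e ↔ d = e ∨ e.level < d.level := Iff.rfl

theorem le_of_level_lt {d e : Ladder} (h : e.level < d.level) : d ≤ e := Or.inr h

theorem level_le {d e : Ladder} (h : d ≤ e) : e.level ≤ d.level := by
  rcases h with rfl | h
  · exact le_rfl
  · exact h.le

@[simp] theorem level_top : top.level = 0 := rfl

@[simp] theorem level_node (i : ℕ) (s : Bool) : (node i s).level = i + 1 := rfl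

theorem le_top (d : Ladder) : d ≤ top := by
  cases d with
  | top => exact le_rfl
  | node i s => exact Or.inr (Nat.succ_pos i)

theorem level_eq_of_not_le {d e : Ladder} (h : ¬ d ≤ e) (h' : ¬ e ≤ d) : d.level = e.level :=
  le_antisymm (not_lt.1 fun hl => h (Or.inr hl)) (not_lt.1 fun hl => h' (Or.inr hl))

/-- Take `m` of least level among the points above `y` that refute `p`. It has a strict successor
`z` with `p` but not `q`. A point `x` with `q` but not `p` is either strictly above `m`, against
minimality, or below `z`, which would pass `q` to `z`. -/
theorem weakPeirce_mem : SILogic.weakPeirce ∈ (logicOf Ladder).carrier := by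
  intro V hV d
  by_contra H
  obtain ⟨H₁, H₂⟩ := not_or.1 H
  simp only [Forces, not_forall] at H₁ H₂
  obtain ⟨x, hx, hxq, hxp⟩ := H₁
  obtain ⟨y, hy, hyp, hyn⟩ := H₂
  obtain ⟨m, ⟨hym, hmp⟩, hmin⟩ := WellFounded.has_min (measure level).wf
    {m | y ≤ m ∧ ¬ V 0 m} ⟨y, le_rfl, hyn⟩
  have hz : ∃ z, m ≤ z ∧ V 0 z ∧ ¬ V 1 z := by
    by_contra hz
    push Not at hz
    exact hmp (hyp m hym hz)
  obtain ⟨z, hmz, hzp, hzq⟩ := hz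
  have hlt : z.level < m.level := hmz.resolve_left fun h => hmp (h ▸ hzp)
  by_cases hxm : x.level < m.level
  · exact hmin x ⟨hym.trans (Or.inr hxm), hxp⟩ hxm
  · exact hzq (hV 1 x z (Or.inr (hlt.trans_le (not_lt.1 hxm))) hxq)

theorem eq_or_eq_or_eq_of_level_eq {x y z : Ladder} (h₁ : x.level = y.level)
    (h₂ : x.level = z.level) : x = y ∨ x = z ∨ y = z := by
  cases x with
  | top => cases y with
    | top => exact Or.inl rfl
    | node => simp at h₁
  | node i s => cases y with
    | top => simp at h₁
    | node j t => cases z with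
      | top => simp at h₂
      | node k r =>
        simp only [level_node, Nat.add_right_cancel_iff] at h₁ h₂
        subst h₁ h₂
        cases s <;> cases t <;> cases r <;> simp

/-- Witnesses against the three disjuncts are pairwise incomparable, hence on one level, which has
at most two points. -/
theorem bw₂_mem : SILogic.bw₂ ∈ (logicOf Ladder).carrier := by
  intro V hV d
  by_contra H
  obtain ⟨H', H₂⟩ := not_or.1 H
  obtain ⟨H₀, H₁⟩ := not_or.1 H'
  simp only [Forces, not_forall, not_or] at H₀ H₁ H₂
  obtain ⟨x, -, hx₀, hx₁, hx₂⟩ := H₀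
  obtain ⟨y, -, hy₁, hy₀, hy₂⟩ := H₁
  obtain ⟨z, -, hz₂, hz₀, hz₁⟩ := H₂
  have hxy : x.level = y.level :=
    level_eq_of_not_le (fun h => hy₀ (hV _ _ _ h hx₀)) fun h => hx₁ (hV _ _ _ h hy₁)
  have hxz : x.level = z.level :=
    level_eq_of_not_le (fun h => hz₀ (hV _ _ _ h hx₀)) fun h => hx₂ (hV _ _ _ h hz₂)
  rcases eq_or_eq_or_eq_of_level_eq hxy hxz with rfl | rfl | rfl
  · exact hy₀ hx₀
  · exact hz₀ hx₀
  · exact hz₁ hy₁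

theorem weakExcludedMiddle_mem : SILogic.weakExcludedMiddle ∈ (logicOf Ladder).carrier := by
  intro V hV d
  by_cases h : V 0 top
  · exact Or.inr fun u _ hu => hu top (le_top u) h
  · exact Or.inl fun u _ hu => h (hV 0 u top (le_top u) hu)

theorem box_subset_logicOf : SILogic.Box.carrier ⊆ (logicOf Ladder).carrier :=
  SILogic.box_subset weakPeirce_mem bw₂_mem weakExcludedMiddle_mem

/-- Consecutive levels overlap in one index. -/
def index : Ladder → ℕ
  | top => 0
  | node i false => i + 1
  | node i true => i + 2

/-- The valuation under which `p_j` holds at the points of index at most `j`. -/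
def indexVal (j : ℕ) (d : Ladder) : Prop := d.index ≤ j

theorem level_le_index (d : Ladder) : d.level ≤ d.index := by
  rcases d with _ | ⟨i, _ | _⟩ <;> simp [index]

theorem index_le_level (d : Ladder) : d.index ≤ d.level + 1 := by
  rcases d with _ | ⟨i, _ | _⟩ <;> simp [index]

theorem persistent_indexVal : Persistent indexVal := by
  rintro j d e (rfl | h) hd
  · exact hd
  · have := level_le_index d
    have := index_le_level e
    simp only [indexVal] at *
    omega

/-- Formulas of depth at most `i` do not separate `node i true` from `node (i + 1) false`. -/
theorem forces_indexVal_iff (φ : Formula) (i : ℕ) (h : φ.depth ≤ i) :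
    Forces indexVal (node i true) φ ↔ Forces indexVal (node (i + 1) false) φ := by
  induction φ generalizing i with
  | var j => rfl
  | bot => rfl
  | top => rfl
  | and φ ψ ih₁ ih₂ =>
    exact and_congr (ih₁ i (le_of_max_le_left h)) (ih₂ i (le_of_max_le_right h))
  | or φ ψ ih₁ ih₂ =>
    exact or_congr (ih₁ i (le_of_max_le_left h)) (ih₂ i (le_of_max_le_right h))
  | imp φ ψ ih₁ ih₂ =>
    refine ⟨fun H => ?_, fun H => H.mono persistent_indexVal (Or.inr (by simp))⟩
    simp only [Formula.depth] at h
    obtain ⟨i, rfl⟩ : ∃ k, i = k + 1 := ⟨i - 1, by omega⟩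
    have h₁ : φ.depth ≤ i := by omega
    have h₂ : ψ.depth ≤ i := by omega
    rintro e (rfl | he) hφ
    · exact (ih₂ _ (by omega)).1 (H _ le_rfl ((ih₁ _ (by omega)).2 hφ))
    · rcases e with _ | ⟨j, s⟩
      · exact H _ (le_top _) hφ
      · simp only [level_node] at he
        rcases (show j ≤ i + 1 by omega).lt_or_eq with hj | rfl
        · exact H _ (Or.inr (by simpa using hj)) hφ
        · cases s with
          | true => exact H _ le_rfl hφ
          | false =>
            -- This is the only successor not above `node (i + 1) true`. One unit of depth pays for
            -- replacing it by `node i true`, which is.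
            exact (ih₂ i h₂).1 (H _ (Or.inr (by simp)) ((ih₁ i h₁).2 hφ))

/-- Formulas that separate `node n true` from `node n false`. -/
def separator : ℕ → Formula
  | 0 => .var 0
  | n + 1 => .var (n + 1) ⇒ₚ separator n ∨ₚ .var n

/-- The second part follows from the first because `node n false` has index `n + 1`. The first part
for `n + 1` follows from the second for `n` by persistence. -/
theorem not_forces_separator (n : ℕ) : ¬ Forces indexVal (node n false) (separator n) ∧
    ¬ Forces indexVal (node n false) (separator (n + 1)) := by
  have key : ∀ n, ¬ Forces indexVal (node n false) (separator n) →
      ¬ Forces indexVal (node n false) (separator (n + 1)) := by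
    intro n hn H
    rcases H _ le_rfl (le_refl (n + 1)) with h | h
    · exact hn h
    · exact absurd (show n + 1 ≤ n from h) (by omega)
  suffices h : ¬ Forces indexVal (node n false) (separator n) from ⟨h, key n h⟩
  induction n with
  | zero => exact fun h => absurd (show 0 + 1 ≤ 0 from h) (by omega)
  | succ n ih => exact fun h => key n ih (h.mono persistent_indexVal (Or.inr (by simp)))

/-- A successor of `node (n + 1) true` of index exactly `n + 2` can only be `node n true`, where the
previous separator holds. -/
theorem forces_separator (n : ℕ) : Forces indexVal (node n true) (separator (n + 1)) := by
  induction n with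
  | zero =>
    rintro e he (hi : e.index ≤ 1)
    right
    change e.index ≤ 0
    rcases e with _ | ⟨j, s⟩
    · exact le_rfl
    · have := level_le he
      simp only [level_node] at this
      obtain rfl : j = 0 := by omega
      rcases he with he | he
      · cases he
        simp [index] at hi
      · simp at he
  | succ n ih =>
    rintro e he (hi : e.index ≤ n + 2)
    by_cases h : e.index ≤ n + 1
    · exact Or.inr h
    · left
      rcases e with _ | ⟨j, _ | _⟩
      · simp [index] at h
      · rcases he with he | he
        · cases he
        · simp only [index, level_node] at h he
          omega
      · simp only [index] at h hi
        obtain rfl : j = n := by omega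
        exact ih

theorem not_isUniformlyLocallyTabular_box : ¬ SILogic.Box.IsUniformlyLocallyTabular := by
  rintro ⟨n, hn⟩
  obtain ⟨ψ, hd, hψ⟩ := hn (separator (n + 1))
  have H := box_subset_logicOf hψ indexVal persistent_indexVal
  have h₁ := (H (node n true)).1 _ le_rfl (forces_separator n)
  have h₂ := (forces_indexVal_iff ψ n hd).1 h₁
  have h₃ := (H (node (n + 1) false)).2 _ le_rfl h₂
  exact (not_forces_separator (n + 1)).1 h₃

end Ladder

/-! ### Theories and prime theories -/

/-- Sets of formulas that contain intuitionistic logic and are closed under modus ponens. -/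
structure IsTheory (Γ : Set Formula) : Prop where
  ipc : ∀ φ, IPCProvable φ → φ ∈ Γ
  mp : ∀ {φ ψ}, (φ ⇒ₚ ψ) ∈ Γ → φ ∈ Γ → ψ ∈ Γ

theorem SILogic.isTheory (L : SILogic) : IsTheory L.carrier := ⟨L.ipc_mem, L.mp_mem _ _⟩

namespace IsTheory

variable {Γ : Set Formula} {φ ψ χ ξ : Formula}

theorem imp_of_mem (h : IsTheory Γ) (hψ : ψ ∈ Γ) (φ : Formula) : (φ ⇒ₚ ψ) ∈ Γ :=
  h.mp (h.ipc _ (.k _ _)) hψ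

/-- The formulas implied by `φ` modulo a theory form a theory. -/
theorem imp (h : IsTheory Γ) (φ : Formula) : IsTheory {ψ | (φ ⇒ₚ ψ) ∈ Γ} where
  ipc ψ hψ := h.imp_of_mem (h.ipc ψ hψ) φ
  mp h₁ h₂ := h.mp (h.mp (h.ipc _ (.s _ _ _)) h₁) h₂

theorem imp_self (h : IsTheory Γ) (φ : Formula) : (φ ⇒ₚ φ) ∈ Γ :=
  h.mp (h.mp (h.ipc _ (.s φ (φ ⇒ₚ φ) φ)) (h.ipc _ (.k _ _))) (h.ipc _ (.k _ _))

theorem trans (h : IsTheory Γ) (h₁ : (φ ⇒ₚ ψ) ∈ Γ) (h₂ : (ψ ⇒ₚ χ) ∈ Γ) : (φ ⇒ₚ χ) ∈ Γ :=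
  (h.imp φ).mp (h.imp_of_mem h₂ φ) h₁

theorem and_mem (h : IsTheory Γ) (h₁ : φ ∈ Γ) (h₂ : ψ ∈ Γ) : φ ∧ₚ ψ ∈ Γ :=
  h.mp (h.mp (h.ipc _ (.andIntro _ _)) h₁) h₂

theorem imp_and (h : IsTheory Γ) (h₁ : (φ ⇒ₚ ψ) ∈ Γ) (h₂ : (φ ⇒ₚ χ) ∈ Γ) :
    (φ ⇒ₚ ψ ∧ₚ χ) ∈ Γ :=
  (h.imp φ).and_mem h₁ h₂

theorem or_imp (h : IsTheory Γ) (h₁ : (φ ⇒ₚ χ) ∈ Γ) (h₂ : (ψ ⇒ₚ χ) ∈ Γ) :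
    (φ ∨ₚ ψ ⇒ₚ χ) ∈ Γ :=
  h.mp (h.mp (h.ipc _ (.orElim _ _ _)) h₁) h₂

theorem or_imp_or (h : IsTheory Γ) (h₁ : (φ ⇒ₚ χ) ∈ Γ) (h₂ : (ψ ⇒ₚ ξ) ∈ Γ) :
    (φ ∨ₚ ψ ⇒ₚ χ ∨ₚ ξ) ∈ Γ :=
  h.or_imp (h.trans h₁ (h.ipc _ (.orLeft _ _))) (h.trans h₂ (h.ipc _ (.orRight _ _)))

/-- The theory generated by a theory and a set of formulas closed under conjunction. -/
theorem directed (h : IsTheory Γ) {A : Set Formula} (htop : Formula.top ∈ A)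
    (hA : ∀ a ∈ A, ∀ b ∈ A, a ∧ₚ b ∈ A) : IsTheory {ψ | ∃ a ∈ A, (a ⇒ₚ ψ) ∈ Γ} where
  ipc ψ hψ := ⟨_, htop, h.imp_of_mem (h.ipc ψ hψ) _⟩
  mp := by
    rintro φ ψ ⟨a, ha, h₁⟩ ⟨b, hb, h₂⟩
    exact ⟨_, hA a ha b hb, (h.imp _).mp (h.trans (h.ipc _ (.andLeft _ _)) h₁)
      (h.trans (h.ipc _ (.andRight _ _)) h₂)⟩

end IsTheory

/-- Consistent prime theories. -/
structure PrimeTheory where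
  carrier : Set Formula
  isTheory : IsTheory carrier
  bot_notMem : Formula.bot ∉ carrier
  prime : ∀ {φ ψ}, φ ∨ₚ ψ ∈ carrier → φ ∈ carrier ∨ ψ ∈ carrier

namespace PrimeTheory

instance : Membership Formula PrimeTheory := ⟨fun T φ => φ ∈ T.carrier⟩

theorem ext_carrier {S T : PrimeTheory} (h : S.carrier = T.carrier) : S = T := by
  cases S
  cases T
  cases h
  rfl

instance : PartialOrder PrimeTheory where
  le S T := S.carrier ⊆ T.carrier
  le_refl _ := Set.Subset.rfl
  le_trans _ _ _ := Set.Subset.trans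
  le_antisymm _ _ h₁ h₂ := ext_carrier (h₁.antisymm h₂)

variable {S T : PrimeTheory} {φ ψ : Formula}

theorem mem_of_le (h : S ≤ T) (hφ : φ ∈ S) : φ ∈ T := h hφ

theorem exists_of_not_le (h : ¬ S ≤ T) : ∃ φ, φ ∈ S ∧ φ ∉ T := Set.not_subset.1 h

theorem eq_of_mem_iff (h : ∀ φ, φ ∈ S ↔ φ ∈ T) : S = T := ext_carrier (Set.ext h)

theorem mp_mem (h₁ : (φ ⇒ₚ ψ) ∈ T) (h₂ : φ ∈ T) : ψ ∈ T := T.isTheory.mp h₁ h₂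

theorem bot_notMem' (T : PrimeTheory) : Formula.bot ∉ T := T.bot_notMem

theorem top_mem (T : PrimeTheory) : Formula.top ∈ T := T.isTheory.ipc _ .topIntro

theorem and_mem_iff : φ ∧ₚ ψ ∈ T ↔ φ ∈ T ∧ ψ ∈ T :=
  ⟨fun h => ⟨T.isTheory.mp (T.isTheory.ipc _ (.andLeft _ _)) h,
    T.isTheory.mp (T.isTheory.ipc _ (.andRight _ _)) h⟩, fun h => T.isTheory.and_mem h.1 h.2⟩

theorem or_mem_iff : φ ∨ₚ ψ ∈ T ↔ φ ∈ T ∨ ψ ∈ T :=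
  ⟨T.prime, fun h => h.elim (fun h => T.isTheory.mp (T.isTheory.ipc _ (.orLeft _ _)) h)
    fun h => T.isTheory.mp (T.isTheory.ipc _ (.orRight _ _)) h⟩

/-- A theory disjoint from a set of formulas closed under disjunction extends to a prime theory
disjoint from it. -/
theorem exists_disjoint {Γ Δ : Set Formula} (hΓ : IsTheory Γ) (hbot : Formula.bot ∈ Δ)
    (hΔ : ∀ a ∈ Δ, ∀ b ∈ Δ, a ∨ₚ b ∈ Δ) (hdisj : ∀ φ ∈ Γ, φ ∉ Δ) :
    ∃ T : PrimeTheory, Γ ⊆ T.carrier ∧ ∀ φ ∈ T, φ ∉ Δ := by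
  obtain ⟨M, hΓM, hM⟩ := zorn_subset_nonempty {M | IsTheory M ∧ ∀ φ ∈ M, φ ∉ Δ}
    (fun c hc hchain hne => by
      refine ⟨⋃₀ c, ⟨⟨fun φ hφ => ?_, ?_⟩, ?_⟩, fun s hs => Set.subset_sUnion_of_mem hs⟩
      · obtain ⟨s, hs⟩ := hne
        exact ⟨s, hs, (hc hs).1.ipc φ hφ⟩
      · rintro φ ψ ⟨s, hs, hφ⟩ ⟨t, ht, hψ⟩
        rcases hchain.total hs ht with h | h
        · exact ⟨t, ht, (hc ht).1.mp (h hφ) hψ⟩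
        · exact ⟨s, hs, (hc hs).1.mp hφ (h hψ)⟩
      · rintro φ ⟨s, hs, hφ⟩
        exact (hc hs).2 φ hφ) Γ ⟨hΓ, hdisj⟩
  have hth := hM.prop.1
  -- Otherwise the theory generated by `M` and `φ` still avoids `Δ`, and maximality puts `φ` in `M`.
  have key : ∀ φ, φ ∉ M → ∃ δ ∈ Δ, (φ ⇒ₚ δ) ∈ M := by
    intro φ hφ
    by_contra hcon
    push Not at hcon
    have hle : M ⊆ {ψ | (φ ⇒ₚ ψ) ∈ M} := fun ψ hψ => hth.imp_of_mem hψ φ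
    exact hφ (hM.le_of_ge ⟨hth.imp φ, fun ψ hψ hψ' => hcon ψ hψ' hψ⟩ hle (hth.imp_self φ))
  refine ⟨⟨M, hth, fun h => hM.prop.2 _ h hbot, fun {φ ψ} h => ?_⟩, hΓM, hM.prop.2⟩
  by_contra hcon
  obtain ⟨h₁, h₂⟩ := not_or.1 hcon
  obtain ⟨δ₁, hδ₁, h₁⟩ := key _ h₁
  obtain ⟨δ₂, hδ₂, h₂⟩ := key _ h₂
  exact hM.prop.2 _ (hth.mp (hth.or_imp_or h₁ h₂) h) (hΔ _ hδ₁ _ hδ₂)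

/-- Separation of a set of formulas closed under conjunction from one closed under disjunction. -/
theorem exists_separating {Γ A Δ : Set Formula} (hΓ : IsTheory Γ) (htop : Formula.top ∈ A)
    (hA : ∀ a ∈ A, ∀ b ∈ A, a ∧ₚ b ∈ A) (hbot : Formula.bot ∈ Δ)
    (hΔ : ∀ a ∈ Δ, ∀ b ∈ Δ, a ∨ₚ b ∈ Δ) (h : ∀ a ∈ A, ∀ δ ∈ Δ, (a ⇒ₚ δ) ∉ Γ) :
    ∃ T : PrimeTheory, Γ ⊆ T.carrier ∧ (∀ a ∈ A, a ∈ T) ∧ ∀ δ ∈ Δ, δ ∉ T := by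
  obtain ⟨T, hT, hTΔ⟩ := exists_disjoint (hΓ.directed htop hA) hbot hΔ
    (by rintro φ ⟨a, ha, haφ⟩ hφ; exact h a ha φ hφ haφ)
  exact ⟨T, fun φ hφ => hT ⟨_, htop, hΓ.imp_of_mem hφ _⟩,
    fun a ha => hT ⟨a, ha, hΓ.imp_self a⟩, fun δ hδ hδT => hTΔ δ hδT hδ⟩

theorem exists_notMem {Γ : Set Formula} (hΓ : IsTheory Γ) (hφ : φ ∉ Γ) :
    ∃ T : PrimeTheory, Γ ⊆ T.carrier ∧ φ ∉ T := by
  obtain ⟨T, hT, hTΔ⟩ := exists_disjoint hΓ (Δ := {δ | (δ ⇒ₚ φ) ∈ Γ}) (hΓ.ipc _ (.exFalso _))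
    (fun a ha b hb => hΓ.or_imp ha hb) (fun ψ hψ hψ' => hφ (hΓ.mp hψ' hψ))
  exact ⟨T, hT, fun h => hTΔ φ h (hΓ.imp_self φ)⟩

theorem imp_mem_iff : (φ ⇒ₚ ψ) ∈ T ↔ ∀ S, T ≤ S → φ ∈ S → ψ ∈ S := by
  refine ⟨fun h S hS hφ => mp_mem (mem_of_le hS h) hφ, fun h => ?_⟩
  by_contra hcon
  obtain ⟨S, hS, hψ⟩ := exists_notMem (T.isTheory.imp φ) hcon
  exact hψ (h S (fun χ hχ => hS (T.isTheory.imp_of_mem hχ φ)) (hS (T.isTheory.imp_self φ)))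

/-- The canonical valuation. -/
def val (i : ℕ) (T : PrimeTheory) : Prop := Formula.var i ∈ T

theorem forces_val_iff : Forces val T φ ↔ φ ∈ T := by
  induction φ generalizing T with
  | var i => rfl
  | bot => exact iff_of_false id T.bot_notMem
  | top => exact iff_of_true trivial T.top_mem
  | and φ ψ ih₁ ih₂ => exact (and_congr ih₁ ih₂).trans and_mem_iff.symm
  | or φ ψ ih₁ ih₂ => exact (or_congr ih₁ ih₂).trans or_mem_iff.symm
  | imp φ ψ ih₁ ih₂ =>
    refine Iff.trans ?_ imp_mem_iff.symm
    exact forall_congr' fun S => imp_congr_right fun _ => imp_congr ih₁ ih₂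

/-- Prime theories related by a bisimulation are equal. -/
theorem eq_of_bisimulation (R : PrimeTheory → PrimeTheory → Prop)
    (hvar : ∀ S T, R S T → ∀ i, Formula.var i ∈ S ↔ Formula.var i ∈ T)
    (forth : ∀ S T, R S T → ∀ S', S ≤ S' → ∃ T', T ≤ T' ∧ R S' T')
    (back : ∀ S T, R S T → ∀ T', T ≤ T' → ∃ S', S ≤ S' ∧ R S' T') (h : R S T) : S = T :=
  eq_of_mem_iff fun φ => forces_val_iff.symm.trans
    ((forces_iff_of_bisimulation R hvar forth back φ h).trans forces_val_iff)

/-! ### Agreement on formulas of bounded depth -/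

/-- Agreement on the formulas of depth at most `n`. -/
def DepthEquiv (n : ℕ) (S T : PrimeTheory) : Prop :=
  ∀ φ : Formula, φ.depth ≤ n → (φ ∈ S ↔ φ ∈ T)

namespace DepthEquiv

variable {m n : ℕ} {U : PrimeTheory}

theorem mono (h : DepthEquiv n S T) (hmn : m ≤ n) : DepthEquiv m S T :=
  fun φ hφ => h φ (hφ.trans hmn)

theorem symm (h : DepthEquiv n S T) : DepthEquiv n T S := fun φ hφ => (h φ hφ).symm

theorem trans (h : DepthEquiv n S T) (h' : DepthEquiv n T U) : DepthEquiv n S U :=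
  fun φ hφ => (h φ hφ).trans (h' φ hφ)

theorem var_iff (h : DepthEquiv n S T) (i : ℕ) : Formula.var i ∈ S ↔ Formula.var i ∈ T :=
  h _ (Nat.zero_le _)

end DepthEquiv

/-- If an implication from a depth-`n` member of `T'` to a depth-`n` non-member were in `S`, it
would have depth at most `n + 1` and so pass to `T` and `T'`. The two sets can therefore be
separated over `S`. -/
theorem exists_depthEquiv_of_imp {n : ℕ} (h : ∀ φ : Formula, φ.depth ≤ n + 1 → φ ∈ S → φ ∈ T)
    {T' : PrimeTheory} (hT' : T ≤ T') : ∃ S', S ≤ S' ∧ DepthEquiv n S' T' := by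
  obtain ⟨S', hS', hA, hΔ⟩ := exists_separating S.isTheory
    (A := {φ | φ.depth ≤ n ∧ φ ∈ T'}) (Δ := {φ | φ.depth ≤ n ∧ φ ∉ T'})
    ⟨Nat.zero_le _, T'.top_mem⟩
    (fun a ha b hb => ⟨max_le ha.1 hb.1, and_mem_iff.2 ⟨ha.2, hb.2⟩⟩)
    ⟨Nat.zero_le _, T'.bot_notMem⟩
    (fun a ha b hb => ⟨max_le ha.1 hb.1, fun h => (or_mem_iff.1 h).elim ha.2 hb.2⟩)
    (fun a ha δ hδ haδ => hδ.2 (mp_mem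
      (mem_of_le hT' (h _ (Nat.succ_le_succ (max_le ha.1 hδ.1)) haδ)) ha.2))
  refine ⟨S', hS', fun φ hφ => ⟨fun hφS => ?_, fun hφT => hA φ ⟨hφ, hφT⟩⟩⟩
  by_contra hφT
  exact hΔ φ ⟨hφ, hφT⟩ hφS

theorem DepthEquiv.exists_left {n : ℕ} (h : DepthEquiv (n + 1) S T) {T' : PrimeTheory}
    (hT' : T ≤ T') : ∃ S', S ≤ S' ∧ DepthEquiv n S' T' :=
  exists_depthEquiv_of_imp (fun φ hφ => (h φ hφ).1) hT'

theorem DepthEquiv.exists_right {n : ℕ} (h : DepthEquiv (n + 1) S T) {S' : PrimeTheory}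
    (hS' : S ≤ S') : ∃ T', T ≤ T' ∧ DepthEquiv n S' T' := by
  obtain ⟨T', hT', h'⟩ := h.symm.exists_left hS'
  exact ⟨T', hT', h'.symm⟩

/-- If formulas of depth `n` separate the points above each point, then agreement up to depth
`n + 2` is equality. -/
theorem DepthEquiv.eq_of_locally_separated {n : ℕ}
    (hS : ∀ x, S ≤ x → ∀ y, S ≤ y → DepthEquiv n x y → x = y)
    (hT : ∀ x, T ≤ x → ∀ y, T ≤ y → DepthEquiv n x y → x = y)
    (h : DepthEquiv (n + 2) S T) : S = T := by
  refine eq_of_bisimulation (fun x y => S ≤ x ∧ T ≤ y ∧ DepthEquiv (n + 1) x y)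
    (fun x y h => h.2.2.var_iff) ?_ ?_ ⟨le_rfl, le_rfl, h.mono (Nat.le_succ _)⟩
  · rintro x y ⟨hx, hy, hxy⟩ x' hx'
    obtain ⟨y', hy', hxy'⟩ := hxy.exists_right hx'
    -- `y'` is above `y` but matches `x'` only to depth `n`; `y''` matches it to depth `n + 1` but
    -- is only known to be above `T`. Local separation identifies the two.
    obtain ⟨y'', hy'', hxy''⟩ := h.exists_right (hx.trans hx')
    obtain rfl : y' = y'' := hT _ (hy.trans hy') _ hy''
      (hxy'.symm.trans (hxy''.mono (Nat.le_succ _)))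
    exact ⟨y', hy', hx.trans hx', hy'', hxy''⟩
  · rintro x y ⟨hx, hy, hxy⟩ y' hy'
    obtain ⟨x', hx', hxy'⟩ := hxy.exists_left hy'
    obtain ⟨x'', hx'', hxy''⟩ := h.exists_left (hy.trans hy')
    obtain rfl : x' = x'' := hS _ (hx.trans hx') _ hx''
      (hxy'.trans (hxy''.mono (Nat.le_succ _)).symm)
    exact ⟨x', hx', hx'', hy.trans hy', hxy''⟩

end PrimeTheory

open PrimeTheory in
/-- A logic is `n`-uniform if inclusion between its prime theories is determined by the formulas
of depth at most `n`. -/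
theorem SILogic.isNUniform_of_prime {L : SILogic} {n : ℕ}
    (h : ∀ S T : PrimeTheory, L.carrier ⊆ S.carrier → L.carrier ⊆ T.carrier →
      (∀ φ : Formula, φ.depth ≤ n → φ ∈ S → φ ∈ T) → S ≤ T) : L.IsNUniform n := by
  intro φ
  by_contra hcon
  push Not at hcon
  have hL := L.isTheory
  -- `T` contains the depth-`n` consequences of `φ` but not `φ`; such a `T` exists unless one of
  -- these consequences is equivalent to `φ`.
  obtain ⟨T, hT, hTA, hTΔ⟩ := exists_separating hL
    (A := {ψ | ψ.depth ≤ n ∧ (φ ⇒ₚ ψ) ∈ L.carrier}) (Δ := {ψ | (ψ ⇒ₚ φ) ∈ L.carrier})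
    ⟨Nat.zero_le _, hL.imp_of_mem (hL.ipc _ .topIntro) _⟩
    (fun a ha b hb => ⟨max_le ha.1 hb.1, hL.imp_and ha.2 hb.2⟩)
    (hL.ipc _ (.exFalso _)) (fun a ha b hb => hL.or_imp ha hb)
    (fun a ha δ hδ haδ => hcon a ha.1 (hL.and_mem ha.2 (hL.trans haδ hδ)))
  -- `S` contains `φ`, while all its formulas of depth at most `n` lie in `T`.
  obtain ⟨S, hS, hSA, hSΔ⟩ := exists_separating hL
    (A := {ψ | (φ ⇒ₚ ψ) ∈ L.carrier}) (Δ := {ψ | ψ.depth ≤ n ∧ ψ ∉ T})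
    (hL.imp_of_mem (hL.ipc _ .topIntro) _)
    (fun a ha b hb => hL.imp_and ha hb)
    ⟨Nat.zero_le _, T.bot_notMem⟩
    (fun a ha b hb => ⟨max_le ha.1 hb.1, fun h => (or_mem_iff.1 h).elim ha.2 hb.2⟩)
    (fun a ha δ hδ haδ => hδ.2 (hTA δ ⟨hδ.1, hL.trans ha haδ⟩))
  refine hTΔ φ (hL.imp_self φ) (h S T hS hT (fun ψ hψ hψS => ?_) (hSA φ (hL.imp_self φ)))
  by_contra hψT
  exact hSΔ ψ ⟨hψ, hψT⟩ hψS

-- Inclusion up to depth `n + 3` gives a point above `S` that agrees with `T` up to depth `n + 2`,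
-- and this point is `T` itself.
open PrimeTheory in
theorem SILogic.isUniformlyLocallyTabular_of_locally_separated {L : SILogic} {n : ℕ}
    (h : ∀ T : PrimeTheory, L.carrier ⊆ T.carrier →
      ∀ x, T ≤ x → ∀ y, T ≤ y → DepthEquiv n x y → x = y) : L.IsUniformlyLocallyTabular := by
  refine ⟨n + 3, isNUniform_of_prime fun S T hS hT hST => ?_⟩
  obtain ⟨S', hS', hST'⟩ := exists_depthEquiv_of_imp (n := n + 2) hST le_rfl
  obtain rfl : S' = T :=
    DepthEquiv.eq_of_locally_separated (h S' (hS.trans hS')) (h T hT) hST'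
  exact hS'

/-! ### The frame of prime theories containing `Box` -/

namespace PrimeTheory

variable {T x y z w : PrimeTheory}

/-- Incomparability. -/
def Incomp (x y : PrimeTheory) : Prop := ¬ x ≤ y ∧ ¬ y ≤ x

theorem Incomp.symm (h : Incomp x y) : Incomp y x := ⟨h.2, h.1⟩

theorem lt_or_eq_or_gt_or_incomp (x y : PrimeTheory) : x < y ∨ x = y ∨ y < x ∨ Incomp x y := by
  by_cases h₁ : x ≤ y
  · rcases h₁.lt_or_eq with h | h
    · exact Or.inl h
    · exact Or.inr (Or.inl h)
  · by_cases h₂ : y ≤ x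
    · exact Or.inr (Or.inr (Or.inl (lt_of_le_not_ge h₂ h₁)))
    · exact Or.inr (Or.inr (Or.inr ⟨h₁, h₂⟩))

/-- If `x < z` agree on the variables, some point above `x` is incomparable to `z`. -/
theorem exists_incomp_of_lt (hxz : x < z)
    (hvar : ∀ i, Formula.var i ∈ x ↔ Formula.var i ∈ z) : ∃ z', x ≤ z' ∧ Incomp z z' := by
  by_contra hcon
  push Not at hcon
  have : x = z := by
    -- If every point above `x` is comparable to `z`, collapsing the interval from `x` to `z` is a
    -- bisimulation.
    refine eq_of_bisimulation (fun u v => u = v ∨ x ≤ u ∧ u ≤ z ∧ v = z) ?_ ?_ ?_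
      (Or.inr ⟨le_rfl, hxz.le, rfl⟩)
    · rintro u v (rfl | ⟨hxu, huz, rfl⟩) i
      · exact Iff.rfl
      · exact ⟨fun h => huz h, fun h => hxu ((hvar i).2 h)⟩
    · rintro u v (rfl | ⟨hxu, huz, rfl⟩) u' hu'
      · exact ⟨u', hu', Or.inl rfl⟩
      · rcases lt_or_eq_or_gt_or_incomp u' v with h | rfl | h | h
        · exact ⟨v, le_rfl, Or.inr ⟨hxu.trans hu', h.le, rfl⟩⟩
        · exact ⟨u', le_rfl, Or.inl rfl⟩
        · exact ⟨u', h.le, Or.inl rfl⟩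
        · exact absurd h.symm (hcon u' (hxu.trans hu'))
    · rintro u v (rfl | ⟨hxu, huz, rfl⟩) v' hv'
      · exact ⟨v', hv', Or.inl rfl⟩
      · exact ⟨v', huz.trans hv', Or.inl rfl⟩
  exact hxz.ne this

/-- Prime theories that contain `Box`. -/
def IsBox (T : PrimeTheory) : Prop := SILogic.Box.carrier ⊆ T.carrier

theorem IsBox.mono (hT : IsBox T) (h : T ≤ x) : IsBox x := fun _ hφ => h (hT hφ)

namespace IsBox

theorem weakPeirce (hT : IsBox T) (p q : Formula) :
    ((q ⇒ₚ p) ∨ₚ (((p ⇒ₚ q) ⇒ₚ p) ⇒ₚ p)) ∈ T :=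
  hT (SILogic.Box.subst_mem (fun i => if i = 0 then p else q) _ SILogic.weakPeirce_mem_box)

theorem boundedWidth (hT : IsBox T) (p q r : Formula) :
    ((p ⇒ₚ q ∨ₚ r) ∨ₚ (q ⇒ₚ p ∨ₚ r) ∨ₚ (r ⇒ₚ p ∨ₚ q)) ∈ T :=
  hT (SILogic.Box.subst_mem (fun i => if i = 0 then p else if i = 1 then q else r) _
    SILogic.bw₂_mem_box)

theorem weakExcludedMiddle (hT : IsBox T) (p : Formula) : (p.neg ∨ₚ p.neg.neg) ∈ T :=
  hT (SILogic.Box.subst_mem (fun _ => p) _ SILogic.weakExcludedMiddle_mem_box)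

/-- Incomparable points have the same points strictly above them. -/
theorem lt_of_incomp_of_lt (hT : IsBox T) (hx : T ≤ x) (hy : T ≤ y) (hxy : Incomp x y)
    (hxz : x < z) : y < z := by
  have key : y ≤ z := by
    intro b hby
    by_contra hbz
    have hbx : b ∉ x := fun h => hbz (mem_of_le hxz.le h)
    obtain ⟨a, hax, hay⟩ := exists_of_not_le hxy.1
    obtain ⟨p, hpz, hpx⟩ := exists_of_not_le hxz.not_ge
    -- Let `P` be the formula `a ∧ ((a ∧ p) ∨ (a ∧ p → b))`. Weak Peirce is applied to `P` and `b`: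
    -- `b → P` fails at `y`, which lacks `a`, and the claim then yields `P ∈ x`. This puts `p` in
    -- `x` or `b` in `z`.
    have hclaim : ((a ∧ₚ ((a ∧ₚ p) ∨ₚ (a ∧ₚ p ⇒ₚ b)) ⇒ₚ b) ⇒ₚ
        a ∧ₚ ((a ∧ₚ p) ∨ₚ (a ∧ₚ p ⇒ₚ b))) ∈ x := by
      refine imp_mem_iff.2 fun S hS hSb => and_mem_iff.2 ⟨mem_of_le hS hax, or_mem_iff.2 ?_⟩
      refine Or.inr (imp_mem_iff.2 fun S' hS' hp => ?_)
      exact imp_mem_iff.1 hSb S' hS'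
        (and_mem_iff.2 ⟨(and_mem_iff.1 hp).1, or_mem_iff.2 (Or.inl hp)⟩)
    rcases or_mem_iff.1 (hT.weakPeirce (a ∧ₚ ((a ∧ₚ p) ∨ₚ (a ∧ₚ p ⇒ₚ b))) b) with h | h
    · exact hay (and_mem_iff.1 (imp_mem_iff.1 h y hy hby)).1
    · rcases or_mem_iff.1 (and_mem_iff.1 (imp_mem_iff.1 h x hx hclaim)).2 with h | h
      · exact hpx (and_mem_iff.1 h).2
      · exact hbz (imp_mem_iff.1 h z hxz.le (and_mem_iff.2 ⟨mem_of_le hxz.le hax, hpz⟩))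
  exact key.lt_of_ne (by rintro rfl; exact hxy.1 hxz.le)

/-- Incomparable points have the same points strictly below them. -/
theorem lt_of_lt_of_incomp (hT : IsBox T) (hy : T ≤ y) (hz : T ≤ z)
    (hxy : Incomp x y) (hzx : z < x) : z < y := by
  rcases lt_or_eq_or_gt_or_incomp z y with h | rfl | h | h
  · exact h
  · exact absurd hzx.le hxy.2
  · exact absurd (h.trans hzx).le hxy.2
  · exact absurd (hT.lt_of_incomp_of_lt hz hy h hzx).le hxy.2

/-- Equal strict successors exclude `y < z` and `z < y`. Otherwise the three points form an
antichain, and formulas each holding at exactly one of them refute `bw₂`. -/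
theorem eq_of_incomp_of_incomp (hT : IsBox T) (hx : T ≤ x) (hy : T ≤ y) (hz : T ≤ z)
    (hxy : Incomp x y) (hxz : Incomp x z) : y = z := by
  rcases lt_or_eq_or_gt_or_incomp y z with h | h | h | h
  · exact absurd (hT.lt_of_incomp_of_lt hy hx hxy.symm h).le hxz.1
  · exact h
  · exact absurd (hT.lt_of_incomp_of_lt hz hx hxz.symm h).le hxy.1
  · have aux : ∀ {u v v' : PrimeTheory}, Incomp u v → Incomp u v' →
        ∃ p, p ∈ u ∧ p ∉ v ∧ p ∉ v' := by
      intro u v v' h₁ h₂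
      obtain ⟨a, ha, ha'⟩ := exists_of_not_le h₁.1
      obtain ⟨b, hb, hb'⟩ := exists_of_not_le h₂.1
      exact ⟨a ∧ₚ b, and_mem_iff.2 ⟨ha, hb⟩, fun h => ha' (and_mem_iff.1 h).1,
        fun h => hb' (and_mem_iff.1 h).2⟩
    obtain ⟨p, hpx, hpy, hpz⟩ := aux hxy hxz
    obtain ⟨q, hqy, hqx, hqz⟩ := aux hxy.symm h
    obtain ⟨r, hrz, hrx, hry⟩ := aux hxz.symm h.symm
    rcases or_mem_iff.1 (hT.boundedWidth p q r) with h | h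
    · rcases or_mem_iff.1 h with h | h
      · exact ((or_mem_iff.1 (imp_mem_iff.1 h x hx hpx)).elim hqx hrx).elim
      · exact ((or_mem_iff.1 (imp_mem_iff.1 h y hy hqy)).elim hpy hry).elim
    · exact ((or_mem_iff.1 (imp_mem_iff.1 h z hz hrz)).elim hpz hqz).elim

/-- Without an upper bound `x` and `y` are jointly inconsistent, so some `a ∈ y` has its negation in
`x`, against weak excluded middle for `a`. -/
theorem exists_upper_bound (hT : IsBox T) (hx : T ≤ x) (hy : T ≤ y) : ∃ z, x ≤ z ∧ y ≤ z := by
  by_contra hcon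
  push Not at hcon
  have : ∃ a ∈ y, (a ⇒ₚ .bot) ∈ x := by
    by_contra hne
    push Not at hne
    obtain ⟨z, hxz, hyz⟩ := exists_notMem (x.isTheory.directed (A := y.carrier) y.top_mem
      (fun a ha b hb => y.isTheory.and_mem ha hb)) (φ := .bot)
      (by rintro ⟨a, ha, h⟩; exact hne a ha h)
    exact hcon z (fun φ hφ => hxz ⟨_, y.top_mem, x.isTheory.imp_of_mem hφ _⟩)
      (fun φ hφ => hxz ⟨φ, hφ, x.isTheory.imp_self φ⟩)
  obtain ⟨a, hay, hax⟩ := this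
  rcases or_mem_iff.1 (hT.weakExcludedMiddle a) with h | h
  · exact y.bot_notMem (imp_mem_iff.1 h y hy hay)
  · exact x.bot_notMem (imp_mem_iff.1 h x hx hax)

/-- Incomparable points differ on a variable. -/
theorem not_varEquiv_of_incomp (hT : IsBox T) (hx : T ≤ x) (hy : T ≤ y) (hxy : Incomp x y) :
    ¬ ∀ i, Formula.var i ∈ x ↔ Formula.var i ∈ y := by
  intro hvar
  have : x = y := by
    refine eq_of_bisimulation (fun u v => u = v ∨ u = x ∧ v = y) ?_ ?_ ?_ (Or.inr ⟨rfl, rfl⟩)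
    · rintro u v (rfl | ⟨rfl, rfl⟩) i
      · exact Iff.rfl
      · exact hvar i
    · rintro u v (rfl | ⟨rfl, rfl⟩) u' hu'
      · exact ⟨u', hu', Or.inl rfl⟩
      · rcases hu'.lt_or_eq with h | rfl
        · exact ⟨u', (hT.lt_of_incomp_of_lt hx hy hxy h).le, Or.inl rfl⟩
        · exact ⟨v, le_rfl, Or.inr ⟨rfl, rfl⟩⟩
    · rintro u v (rfl | ⟨rfl, rfl⟩) v' hv'
      · exact ⟨v', hv', Or.inl rfl⟩
      · rcases hv'.lt_or_eq with h | rfl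
        · exact ⟨v', (hT.lt_of_incomp_of_lt hy hx hxy.symm h).le, Or.inl rfl⟩
        · exact ⟨u, le_rfl, Or.inr ⟨rfl, rfl⟩⟩
  exact hxy.1 this.le

/-- If `x < z` agree on the variables and `z'` is incomparable to `z`, the points strictly above
`x` are those above `z` or `z'`. -/
theorem le_or_le_of_lt {z' : PrimeTheory} (hT : IsBox T) (hx : T ≤ x) (hz' : T ≤ z')
    (hxz : x < z) (hvar : ∀ i, Formula.var i ∈ x ↔ Formula.var i ∈ z) (hzz' : Incomp z z')
    (hxw : x < w) : z ≤ w ∨ z' ≤ w := by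
  have hz := hx.trans hxz.le
  have hw := hx.trans hxw.le
  rcases lt_or_eq_or_gt_or_incomp w z with h | rfl | h | h
  -- A point `w` strictly between `x` and `z` would have an incomparable partner `u`, also between
  -- them. All these points agree on the variables, but incomparable points do not.
  · obtain ⟨u, hxu, hwu⟩ := exists_incomp_of_lt hxw
      fun i => ⟨fun hi => hxw.le hi, fun hi => (hvar i).2 (h.le hi)⟩
    have huz := hT.lt_of_incomp_of_lt hw (hx.trans hxu) hwu h
    refine absurd (fun i => ?_) (hT.not_varEquiv_of_incomp hw (hx.trans hxu) hwu)
    exact ⟨fun hi => hxu ((hvar i).2 (h.le hi)), fun hi => hxw.le ((hvar i).2 (huz.le hi))⟩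
  · exact Or.inl le_rfl
  · exact Or.inl h.le
  · exact Or.inr (hT.eq_of_incomp_of_incomp hz hz' hw hzz' h.symm).le

end IsBox

end PrimeTheory

namespace PrimeTheory

variable {T x y z w : PrimeTheory}

theorem Incomp.lt_of_le {z' : PrimeTheory} (h : Incomp z z') (h₁ : z ≤ x) (h₂ : z' ≤ x) :
    z < x ∧ z' < x :=
  ⟨h₁.lt_of_ne (by rintro rfl; exact h.2 h₂), h₂.lt_of_ne (by rintro rfl; exact h.1 h₁)⟩

/-! ### Logics of long stacks of antichains -/

/-- The antichains `{g i true, g i false}` for `i ≤ N` are consecutive layers above `T`. -/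
structure IsStack (T : PrimeTheory) (N : ℕ) (g : ℕ → Bool → PrimeTheory) : Prop where
  le : ∀ i ≤ N, ∀ s, T ≤ g i s
  incomp : ∀ i ≤ N, ∀ s, Incomp (g i s) (g i !s)
  lt : ∀ i ≤ N, ∀ j < i, ∀ s t, g i s < g j t
  cover : ∀ i < N, ∀ s w, g (i + 1) s < w → ∃ t, g i t ≤ w

/-- Layers are numbered from the top. The lowest is `z` with an incomparable `z'` above `x`. Depth
equivalence matches `z'` with some `w > z`, so `z' < w` agree to one depth less and the induction
continues upwards. The last two conjuncts place the next layer strictly above `z` and `z'`. -/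
theorem IsBox.exists_isStack (hT : IsBox T) (n : ℕ) (hx : T ≤ x) (hxz : x < z)
    (h : DepthEquiv n x z) :
    ∃ g, IsStack T n g ∧ g n true = z ∧ x ≤ g n false := by
  induction n generalizing x z with
  | zero =>
    obtain ⟨z', hz', hzz'⟩ := exists_incomp_of_lt hxz h.var_iff
    refine ⟨fun _ s => cond s z z', ⟨?_, ?_, ?_, ?_⟩, rfl, hz'⟩
    · rintro i - (_ | _)
      exacts [hx.trans hz', hx.trans hxz.le]
    · rintro i - (_ | _)
      exacts [hzz'.symm, hzz']
    · intro i hi j hj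
      omega
    · intro i hi
      omega
  | succ n ih =>
    obtain ⟨z', hz', hzz'⟩ := exists_incomp_of_lt hxz h.var_iff
    have hTz := hx.trans hxz.le
    have hTz' := hx.trans hz'
    obtain ⟨w, hzw, hw⟩ := h.exists_right hz'
    have hzw : z < w := hzw.lt_of_ne (by
      rintro rfl
      exact hT.not_varEquiv_of_incomp hTz' hTz hzz'.symm hw.var_iff)
    have hz'w := hT.lt_of_incomp_of_lt hTz hTz' hzz' hzw
    obtain ⟨g, hg, hgt, hgf⟩ := ih hTz' hz'w hw
    have hTg := hg.le n le_rfl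
    have hinc : Incomp w (g n false) := hgt ▸ hg.incomp n le_rfl true
    have hz'g : z' < g n false := hgf.lt_of_ne (fun e => hinc.2 (e ▸ hz'w.le))
    have hzg := hT.lt_of_incomp_of_lt hTz' hTz hzz'.symm hz'g
    have hlt : ∀ s t, (cond s z z') < g n t := by
      rintro (_ | _) (_ | _)
      exacts [hz'g, hgt ▸ hz'w, hzg, hgt ▸ hzw]
    have hold : ∀ i ≤ n, ∀ s, (if i = n + 1 then cond s z z' else g i s) = g i s :=
      fun i hi s => if_neg (by omega)
    refine ⟨fun i s => if i = n + 1 then cond s z z' else g i s, ⟨?_, ?_, ?_, ?_⟩,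
      by simp, by simpa using hz'⟩
    · intro i hi s
      rcases hi.lt_or_eq with hi | rfl
      · simpa only [hold i (by omega)] using hg.le i (by omega) s
      · cases s <;> simpa
    · intro i hi s
      rcases hi.lt_or_eq with hi | rfl
      · simpa only [hold i (by omega)] using hg.incomp i (by omega) s
      · cases s
        · simpa using hzz'.symm
        · simpa using hzz'
    · intro i hi j hj s t
      simp only [hold j (by omega)]
      rcases hi.lt_or_eq with hi | rfl
      · simpa only [hold i (by omega)] using hg.lt i (by omega) j hj s t
      · simp only [if_true]
        rcases (show j ≤ n by omega).lt_or_eq with hj | rfl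
        · exact (hlt s true).trans (hg.lt n le_rfl j hj true t)
        · exact hlt s t
    · intro i hi s u
      simp only [hold i (by omega)]
      rcases (show i ≤ n by omega).lt_or_eq with hi | rfl
      · simpa only [hold (i + 1) (by omega)] using hg.cover i hi s u
      · simp only [if_true]
        intro hu
        have hz'u : z' < u := by
          cases s
          · exact hu
          · exact hT.lt_of_incomp_of_lt hTz hTz' hzz' hu
        rcases hT.le_or_le_of_lt hTz' (hTg false) hz'w hw.var_iff hinc hz'u with h | h
        · exact ⟨true, hgt ▸ h⟩
        · exact ⟨false, h⟩

theorem exists_finite_disjunction {s : Set Formula} (hs : s.Finite) :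
    ∃ δ : Formula, ∀ T : PrimeTheory, δ ∈ T ↔ ∃ φ ∈ s, φ ∈ T := by
  induction s, hs using Set.Finite.induction_on with
  | empty => exact ⟨.bot, fun T => by simpa using T.bot_notMem'⟩
  | @insert a s _ _ ih =>
    obtain ⟨δ, hδ⟩ := ih
    exact ⟨a ∨ₚ δ, fun T => by simp [or_mem_iff, hδ]⟩

end PrimeTheory

/-! ### Simulating ladder valuations on a stack -/

theorem Ladder.finite_level_le (N : ℕ) : {d : Ladder | d.level ≤ N + 1}.Finite := by
  refine (((Set.finite_Iic N).prod (Set.finite_univ (α := Bool))).image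
    (fun q => node q.1 q.2) |>.insert top).subset ?_
  rintro (_ | ⟨i, s⟩) hd
  · exact Or.inl rfl
  · exact Or.inr ⟨(i, s), ⟨by simpa using hd, trivial⟩, rfl⟩

namespace PrimeTheory

variable {T : PrimeTheory}

/-- The points of a stack and the points above it, as a cover of the ladder. -/
def StackRel (g : ℕ → Bool → PrimeTheory) (N : ℕ) (u : PrimeTheory) : Ladder → Prop
  | .top => g 0 true < u ∧ g 0 false < u
  | .node i s => i ≤ N ∧ u = g i s

namespace IsStack

variable {N : ℕ} {g : ℕ → Bool → PrimeTheory}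

theorem forth (hg : IsStack T N g) (hT : IsBox T) {u v : PrimeTheory} {d : Ladder}
    (h : StackRel g N u d) (huv : u ≤ v) : ∃ e, d ≤ e ∧ StackRel g N v e := by
  rcases d with _ | ⟨i, s⟩
  · exact ⟨_, le_rfl, h.1.trans_le huv, h.2.trans_le huv⟩
  · obtain ⟨hi, rfl⟩ := h
    induction i generalizing s with
    | zero =>
      rcases huv.lt_or_eq with h | rfl
      · have h' := hT.lt_of_incomp_of_lt (hg.le 0 hi s) (hg.le 0 hi !s) (hg.incomp 0 hi s) h
        refine ⟨.top, Ladder.le_top _, ?_⟩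
        cases s
        exacts [⟨h', h⟩, ⟨h, h'⟩]
      · exact ⟨_, le_rfl, hi, rfl⟩
    | succ i ih =>
      rcases huv.lt_or_eq with h | rfl
      · obtain ⟨t, ht⟩ := hg.cover i hi s v h
        obtain ⟨e, he, hve⟩ := ih t (by omega) ht
        exact ⟨e, (Ladder.le_of_level_lt (by simp)).trans he, hve⟩
      · exact ⟨_, le_rfl, hi, rfl⟩

theorem le_of_le (hg : IsStack T N g) {i j : ℕ} {s t : Bool} (hi : i ≤ N)
    (h : Ladder.node i s ≤ .node j t) : g i s ≤ g j t := by
  rcases h with h | h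
  · cases h
    exact le_rfl
  · exact (hg.lt i hi j (by simpa using h) s t).le

theorem exists_rel_top (hg : IsStack T N g) (hT : IsBox T) {u : PrimeTheory} (hu : T ≤ u) :
    ∃ v, u ≤ v ∧ StackRel g N v .top := by
  obtain ⟨v, h₁, h₂⟩ := hT.exists_upper_bound (hg.le 0 (Nat.zero_le _) true)
    (hg.le 0 (Nat.zero_le _) false)
  obtain ⟨w, hvw, huw⟩ := hT.exists_upper_bound ((hg.le 0 (Nat.zero_le _) true).trans h₁) hu
  have := hg.incomp 0 (Nat.zero_le _) true
  exact ⟨w, huw, this.lt_of_le (h₁.trans hvw) (h₂.trans hvw)⟩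

theorem le_of_rel (hg : IsStack T N g) {u : PrimeTheory} {d : Ladder}
    (h : StackRel g N u d) : T ≤ u := by
  rcases d with _ | ⟨i, s⟩
  · exact (hg.le 0 (Nat.zero_le _) true).trans h.1.le
  · obtain ⟨hi, rfl⟩ := h
    exact hg.le i hi s

theorem back (hg : IsStack T N g) (hT : IsBox T) {u : PrimeTheory} {d e : Ladder}
    (h : StackRel g N u d) (hde : d ≤ e) : ∃ v, u ≤ v ∧ StackRel g N v e := by
  rcases e with _ | ⟨j, t⟩
  · exact hg.exists_rel_top hT (hg.le_of_rel h)
  · rcases d with _ | ⟨i, s⟩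
    · rcases hde with h | h
      · cases h
      · simp at h
    · obtain ⟨hi, rfl⟩ := h
      have := Ladder.level_le hde
      simp only [Ladder.level_node] at this
      exact ⟨g j t, hg.le_of_le hi hde, by omega, rfl⟩

/-- A formula in `g i s` but not in its partner works: each point of the stack not above `g i s` is
below or equal to the partner. The top is cut out by the conjunction of the two formulas for layer
`0`. -/
theorem exists_formula (hg : IsStack T N g) (e : Ladder) (he : e.level ≤ N + 1) :
    ∃ χ : Formula, ∀ u d, StackRel g N u d → (χ ∈ u ↔ e ≤ d) := by
  have key : ∀ i ≤ N, ∀ s, ∃ χ : Formula, ∀ u d, StackRel g N u d → (χ ∈ u ↔ .node i s ≤ d) := by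
    intro i hi s
    obtain ⟨χ, hχ, hχ'⟩ := exists_of_not_le (hg.incomp i hi s).1
    refine ⟨χ, fun u d h => ?_⟩
    rcases d with _ | ⟨j, t⟩
    · refine iff_of_true (mem_of_le ?_ hχ) (Ladder.le_top _)
      have h0 : g 0 s < u := by
        cases s
        exacts [h.2, h.1]
      exact (hg.le_of_le hi (by
        rcases i.eq_zero_or_pos with rfl | h
        · exact le_rfl
        · exact Ladder.le_of_level_lt (by simpa using h))).trans h0.le
    · obtain ⟨hj, rfl⟩ := h
      refine ⟨fun h => ?_, fun h => mem_of_le (hg.le_of_le hi h) hχ⟩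
      by_contra hn
      refine hχ' (mem_of_le (hg.le_of_le hj ?_) h)
      rcases lt_trichotomy i j with hij | rfl | hij
      · exact Ladder.le_of_level_lt (by simpa using hij)
      · have : t ≠ s := by rintro rfl; exact hn le_rfl
        rw [Bool.eq_not_of_ne this]
      · exact absurd (Ladder.le_of_level_lt (by simpa using hij)) hn
  rcases e with _ | ⟨i, s⟩
  · obtain ⟨α, hα⟩ := key 0 (Nat.zero_le _) true
    obtain ⟨β, hβ⟩ := key 0 (Nat.zero_le _) false
    refine ⟨α ∧ₚ β, fun u d h => ?_⟩
    rw [and_mem_iff, hα u d h, hβ u d h]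
    rcases d with _ | ⟨j, t⟩
    · simp [Ladder.le_top]
    · cases t <;> simp [Ladder.le_def]
  · exact key i (by simpa using he) s

/-- Each variable is replaced by the finite disjunction of the formulas defining the points where
`V` makes it true. The instance of `φ` lies in `L`, hence holds throughout the stack, and `StackRel`
carries it to the ladder. -/
theorem forces_ladder (hg : IsStack T N g) (hT : IsBox T) {L : SILogic}
    (hL : L.carrier ⊆ T.carrier) {φ : Formula} (hφ : φ ∈ L.carrier)
    {V : ℕ → Ladder → Prop} (hV : Persistent V) (d : Ladder) (hd : d.level ≤ N + 1) :
    Forces V d φ := by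
  have : Nonempty Formula := ⟨.top⟩
  choose! χ hχ using hg.exists_formula
  have hσ : ∀ p, ∃ δ : Formula, ∀ S : PrimeTheory,
      δ ∈ S ↔ ∃ ψ ∈ χ '' {e | e.level ≤ N + 1 ∧ V p e}, ψ ∈ S := fun p =>
    exists_finite_disjunction
      (((Ladder.finite_level_le N).subset fun e he => he.1).image χ)
  choose σ hσ using hσ
  obtain ⟨u, hu⟩ : ∃ u, StackRel g N u d := by
    rcases d with _ | ⟨i, s⟩
    · obtain ⟨v, -, hv⟩ := hg.exists_rel_top hT (hg.le 0 (Nat.zero_le _) true)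
      exact ⟨v, hv⟩
    · exact ⟨g i s, by simpa using hd, rfl⟩
  refine (forces_iff_of_bisimulation (V := fun i S => Forces val S (σ i)) (StackRel g N)
    (fun S e h i => ?_) (fun S e h S' hS' => hg.forth hT h hS')
    (fun S e h e' he' => hg.back hT h he') φ hu).1
    ((forces_subst σ φ u).1 (forces_val_iff.2 (hg.le_of_rel hu (hL (L.subst_mem σ φ hφ)))))
  rw [forces_val_iff, hσ]
  constructor
  · rintro ⟨_, ⟨e', ⟨he', hVe'⟩, rfl⟩, hS⟩
    exact hV i _ _ ((hχ e' he' S e h).1 hS) hVe'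
  · intro hVe
    have he : e.level ≤ N + 1 := by
      rcases e with _ | ⟨j, t⟩
      · simp
      · simpa using h.1
    exact ⟨_, ⟨e, ⟨he, hVe⟩, rfl⟩, (hχ e he S e h).2 le_rfl⟩

end IsStack

/-- An extension of `Box` that is not uniformly locally tabular is valid on the ladder. -/
theorem _root_.SILogic.subset_logicOf_ladder {L : SILogic} (hL : SILogic.Box.carrier ⊆ L.carrier)
    (h : ¬ L.IsUniformlyLocallyTabular) : L.carrier ⊆ (logicOf Ladder).carrier := by
  intro φ hφ V hV d
  -- Agreement to depth `d.level` suffices, since the resulting stack simulates the levels up to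
  -- `d.level + 1`.
  have hd : ¬ ∀ T : PrimeTheory, L.carrier ⊆ T.carrier →
      ∀ x, T ≤ x → ∀ y, T ≤ y → DepthEquiv d.level x y → x = y :=
    fun H => h (SILogic.isUniformlyLocallyTabular_of_locally_separated H)
  push Not at hd
  obtain ⟨T, hLT, x, hx, y, hy, hxy, hne⟩ := hd
  have hT : IsBox T := hL.trans hLT
  have key : ∀ {x z}, T ≤ x → x < z → DepthEquiv d.level x z → Forces V d φ := by
    intro x z hx hxz h
    obtain ⟨g, hg, -⟩ := hT.exists_isStack d.level hx hxz h
    exact hg.forces_ladder hT hLT hφ hV d (Nat.le_succ _)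
  rcases lt_or_eq_or_gt_or_incomp x y with h | h | h | h
  · exact key hx h hxy
  · exact absurd h hne
  · exact key hy h hxy.symm
  · exact absurd hxy.var_iff (hT.not_varEquiv_of_incomp hx hy h)

end PrimeTheory

namespace PrimeTheory

variable {T x y z w : PrimeTheory}

/-! ### Completeness of `Box` for the ladder -/

namespace IsBox

theorem not_lt_of_lt_of_varEquiv (hT : IsBox T) (hx : T ≤ x) (hxy : x < y) (hyz : y < z)
    (hvar : ∀ i, Formula.var i ∈ x ↔ Formula.var i ∈ z) : False := by
  obtain ⟨z', hz', hzz'⟩ := exists_incomp_of_lt (hxy.trans hyz) hvar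
  rcases hT.le_or_le_of_lt hx (hx.trans hz') (hxy.trans hyz) hvar hzz' hxy with h | h
  · exact hyz.not_ge h
  · exact hzz'.2 (h.trans hyz.le)

/-- Only finitely many points lie above a point that refutes almost all variables. -/
theorem finite_setOf_le (hT : IsBox T) {k : ℕ}
    (hk : ∀ j, k ≤ j → (Formula.var j).neg ∈ T) : {x | T ≤ x}.Finite := by
  refine Set.Finite.of_finite_fibers (fun x : PrimeTheory => {i | Formula.var i ∈ x}) ?_ ?_
  · refine (Set.finite_Iio k).finite_subsets.subset ?_
    rintro _ ⟨x, hx, rfl⟩ i hi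
    by_contra hki
    exact x.bot_notMem (imp_mem_iff.1 (hk i (not_lt.1 hki)) x hx hi)
  · rintro _ ⟨x₀, -, rfl⟩
    set F := {x | T ≤ x} ∩ (fun x : PrimeTheory => {i | Formula.var i ∈ x}) ⁻¹'
      {{i | Formula.var i ∈ x₀}} with hF
    have hvar : ∀ x ∈ F, ∀ y ∈ F, ∀ i, Formula.var i ∈ x ↔ Formula.var i ∈ y :=
      fun x hx y hy i => Set.ext_iff.1 (hx.2.trans hy.2.symm) i
    by_cases hsub : F.Subsingleton
    · exact hsub.finite
    have hlt : ∃ x ∈ F, ∃ z ∈ F, x < z := by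
      obtain ⟨x, hx, y, hy, hne⟩ := Set.not_subsingleton_iff.1 hsub
      rcases lt_or_eq_or_gt_or_incomp x y with h | h | h | h
      · exact ⟨x, hx, y, hy, h⟩
      · exact absurd h hne
      · exact ⟨y, hy, x, hx, h⟩
      · exact absurd (hvar x hx y hy) (hT.not_varEquiv_of_incomp hx.1 hy.1 h)
    obtain ⟨x, hx, z, hz, hxz⟩ := hlt
    -- A fibre is a chain, and three-element chains agreeing on the variables are impossible.
    refine (Set.toFinite {x, z}).subset fun w hw => ?_
    rcases lt_or_eq_or_gt_or_incomp w x with h | h | h | h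
    · exact (hT.not_lt_of_lt_of_varEquiv hw.1 h hxz (hvar w hw z hz)).elim
    · exact Or.inl h
    · rcases lt_or_eq_or_gt_or_incomp w z with h' | h' | h' | h'
      · exact (hT.not_lt_of_lt_of_varEquiv hx.1 h h' (hvar x hx z hz)).elim
      · exact Or.inr h'
      · exact (hT.not_lt_of_lt_of_varEquiv hx.1 hxz h' (hvar x hx w hw)).elim
      · exact absurd (hvar w hw z hz) (hT.not_varEquiv_of_incomp hw.1 hz.1 h')
    · exact absurd (hvar w hw x hx) (hT.not_varEquiv_of_incomp hw.1 hx.1 h)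

/-- The points above `T` that are not strictly below `w` are the image of the first levels of the
ladder under a map that preserves and reflects successors. -/
def HasLadderMap (T w : PrimeTheory) : Prop :=
  ∃ (i : ℕ) (g : Ladder → PrimeTheory),
    (∀ d e, d.level ≤ i → d ≤ e → g d ≤ g e) ∧
    (∀ d, d.level ≤ i → ∀ u, g d ≤ u → ∃ e, d ≤ e ∧ g e = u) ∧
    ∀ u, (T ≤ u ∧ ¬ u < w) ↔ ∃ d, d.level ≤ i ∧ g d = u

theorem hasLadderMap_of_maximal (hT : IsBox T) (hw : T ≤ w) (hmax : ∀ u, ¬ w < u) :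
    HasLadderMap T w := by
  refine ⟨0, fun _ => w, fun _ _ _ _ => le_rfl, fun d _ u hu => ⟨d, le_rfl, ?_⟩, fun u => ?_⟩
  · exact (hu.lt_or_eq).resolve_left (hmax u)
  · constructor
    · rintro ⟨hu, huw⟩
      refine ⟨.top, le_rfl, ?_⟩
      obtain ⟨v, hwv, huv⟩ := hT.exists_upper_bound hw hu
      obtain rfl := (hwv.lt_or_eq).resolve_left (hmax v)
      exact ((huv.lt_or_eq).resolve_left huw).symm
    · rintro ⟨d, -, rfl⟩
      exact ⟨hw, lt_irrefl _⟩

/-- The points not strictly below `w` are those not strictly below `v`, which all lie above `w`,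
together with `w` and its partner if there is one. These last form the new level. -/
theorem hasLadderMap_of_covby (hT : IsBox T) (hw : T ≤ w) {v : PrimeTheory} (hwv : w < v)
    (hcov : ∀ u, w < u → ¬ u < v) (h : HasLadderMap T v) : HasLadderMap T w := by
  obtain ⟨i, g, hmono, hback, himage⟩ := h
  obtain ⟨w', hw', hww', huniq⟩ : ∃ w', T ≤ w' ∧ (w' = w ∨ Incomp w w') ∧
      ∀ u, T ≤ u → Incomp w u → u = w' := by
    by_cases h : ∃ w', T ≤ w' ∧ Incomp w w'
    · obtain ⟨w', hw', hinc⟩ := h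
      exact ⟨w', hw', Or.inr hinc, fun u hu hwu =>
        hT.eq_of_incomp_of_incomp hw hu hw' hwu hinc⟩
    -- Without a partner both nodes of the new level are sent to `w`.
    · exact ⟨w, hw, Or.inl rfl, fun u hu hwu => (h ⟨u, hu, hwu⟩).elim⟩
  have hlt_w : ∀ d : Ladder, d.level ≤ i → w < g d := by
    intro d hd
    obtain ⟨hTd, hdv⟩ := (himage (g d)).2 ⟨d, hd, rfl⟩
    rcases lt_or_eq_or_gt_or_incomp (g d) v with h | h | h | h
    · exact absurd h hdv
    · exact h ▸ hwv
    · exact hwv.trans h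
    · exact hT.lt_of_lt_of_incomp hTd hw h.symm hwv
  have hlt_iff : ∀ u, w < u ↔ w' < u := by
    rcases hww' with rfl | hinc
    · exact fun _ => Iff.rfl
    · exact fun u => ⟨hT.lt_of_incomp_of_lt hw hw' hinc, hT.lt_of_incomp_of_lt hw' hw hinc.symm⟩
  have habove : ∀ u, w < u → ∃ d : Ladder, d.level ≤ i ∧ g d = u :=
    fun u hu => (himage u).1 ⟨hw.trans hu.le, hcov u hu⟩
  classical
  let g' : Ladder → PrimeTheory := fun d => if d.level ≤ i then g d else
    if d = .node i true then w else w'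
  have hg'old : ∀ d : Ladder, d.level ≤ i → g' d = g d := fun d hd => if_pos hd
  have hg'new : ∀ d : Ladder, ¬ d.level ≤ i → g' d = w ∨ g' d = w' := by
    intro d hd
    simp only [g', if_neg hd]
    split_ifs
    exacts [Or.inl rfl, Or.inr rfl]
  have hg't : g' (.node i true) = w := by simp [g']
  have hg'f : g' (.node i false) = w' := by simp [g']
  refine ⟨i + 1, g', ?_, ?_, ?_⟩
  · rintro d e hd (rfl | hde)
    · exact le_rfl
    · have he : e.level ≤ i := by omega
      by_cases hd' : d.level ≤ i
      · rw [hg'old d hd', hg'old e he]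
        exact hmono d e hd' (Or.inr hde)
      · rw [hg'old e he]
        rcases hg'new d hd' with h | h
        · exact h ▸ (hlt_w e he).le
        · exact h ▸ ((hlt_iff _).1 (hlt_w e he)).le
  · intro d hd u hu
    by_cases hd' : d.level ≤ i
    · rw [hg'old d hd'] at hu
      obtain ⟨e, hde, rfl⟩ := hback d hd' u hu
      exact ⟨e, hde, hg'old e ((Ladder.level_le hde).trans hd')⟩
    · rcases hu.lt_or_eq with hlt | rfl
      · have hwu : w < u := by
          rcases hg'new d hd' with h | h
          · exact h ▸ hlt
          · exact (hlt_iff u).2 (h ▸ hlt)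
        obtain ⟨e, he, rfl⟩ := habove u hwu
        exact ⟨e, Or.inr (by omega), hg'old e he⟩
      · exact ⟨d, le_rfl, rfl⟩
  · intro u
    constructor
    · rintro ⟨hu, huw⟩
      rcases lt_or_eq_or_gt_or_incomp u w with h | rfl | h | h
      · exact absurd h huw
      · exact ⟨_, le_rfl, hg't⟩
      · obtain ⟨d, hd, rfl⟩ := habove u h
        exact ⟨d, Nat.le_succ_of_le hd, hg'old d hd⟩
      · exact ⟨_, le_rfl, hg'f.trans (huniq u hu h.symm).symm⟩
    · rintro ⟨d, -, rfl⟩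
      by_cases hd' : d.level ≤ i
      · rw [hg'old d hd']
        exact ⟨hw.trans (hlt_w d hd').le, (hlt_w d hd').asymm⟩
      · rcases hg'new d hd' with h | h
        · rw [h]
          exact ⟨hw, lt_irrefl _⟩
        · rw [h]
          refine ⟨hw', ?_⟩
          rcases hww' with rfl | hinc
          · exact lt_irrefl _
          · exact fun h => hinc.2 h.le

theorem hasLadderMap (hT : IsBox T) (hfin : {x | T ≤ x}.Finite) (hw : T ≤ w) :
    HasLadderMap T w := by
  have hfin' : Finite {x // T ≤ x} := hfin
  suffices H : ∀ w : {x // T ≤ x}, HasLadderMap T w from H ⟨w, hw⟩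
  intro w
  induction w using WellFoundedGT.induction with
  | _ w ih =>
    by_cases hmax : ∃ u, w < u
    · obtain ⟨v, hv, hmin⟩ := wellFounded_lt.has_min {u | w < u} hmax
      exact hT.hasLadderMap_of_covby w.2 hv
        (fun u hu => hmin ⟨u, w.2.trans hu.le⟩ hu) (ih v hv)
    · exact hT.hasLadderMap_of_maximal w.2
        fun u hu => hmax ⟨⟨u, w.2.trans hu.le⟩, hu⟩

end IsBox

end PrimeTheory

/-! ### From finite countermodels to the ladder -/

theorem Formula.exists_subst_eq_self (φ : Formula) :
    ∃ k, ∀ σ : ℕ → Formula, (∀ j < k, σ j = .var j) → φ.subst σ = φ := by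
  have aux : ∀ (c : Formula → Formula → Formula) (φ ψ : Formula),
      (∀ σ φ ψ, (c φ ψ).subst σ = c (φ.subst σ) (ψ.subst σ)) →
      (∃ k, ∀ σ : ℕ → Formula, (∀ j < k, σ j = .var j) → φ.subst σ = φ) →
      (∃ k, ∀ σ : ℕ → Formula, (∀ j < k, σ j = .var j) → ψ.subst σ = ψ) →
      ∃ k, ∀ σ : ℕ → Formula, (∀ j < k, σ j = .var j) → (c φ ψ).subst σ = c φ ψ := by
    rintro c φ ψ hc ⟨k, hk⟩ ⟨l, hl⟩
    refine ⟨max k l, fun σ hσ => ?_⟩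
    rw [hc, hk σ fun j hj => hσ j (hj.trans_le (le_max_left _ _)),
      hl σ fun j hj => hσ j (hj.trans_le (le_max_right _ _))]
  induction φ with
  | var i => exact ⟨i + 1, fun σ hσ => hσ i (Nat.lt_succ_self i)⟩
  | bot => exact ⟨0, fun _ _ => rfl⟩
  | top => exact ⟨0, fun _ _ => rfl⟩
  | and φ ψ ih₁ ih₂ => exact aux .and φ ψ (fun _ _ _ => rfl) ih₁ ih₂
  | or φ ψ ih₁ ih₂ => exact aux .or φ ψ (fun _ _ _ => rfl) ih₁ ih₂
  | imp φ ψ ih₁ ih₂ => exact aux .imp φ ψ (fun _ _ _ => rfl) ih₁ ih₂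

open PrimeTheory in
theorem Ladder.logicOf_subset_box : (logicOf Ladder).carrier ⊆ SILogic.Box.carrier := by
  intro φ hφ
  by_contra hcon
  obtain ⟨k, hk⟩ := φ.exists_subst_eq_self
  let τ : ℕ → Formula := fun j => if j < k then .var j else .bot
  -- Sending the variables absent from `φ` to `⊥` leaves `φ` unprovable and makes the set of points
  -- above the refuting `T` finite.
  have hth : IsTheory {χ : Formula | χ.subst τ ∈ SILogic.Box.carrier} :=
    ⟨fun χ hχ => SILogic.Box.ipc_mem _ (hχ.subst τ), fun h₁ h₂ => SILogic.Box.mp_mem _ _ h₁ h₂⟩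
  obtain ⟨T, hT, hφT⟩ := exists_notMem (φ := φ) hth
    (by
      change φ.subst τ ∉ SILogic.Box.carrier
      rwa [hk τ fun j hj => if_pos hj])
  have hbox : IsBox T := fun χ hχ => hT (SILogic.Box.subst_mem τ χ hχ)
  have hneg : ∀ j, k ≤ j → (Formula.var j).neg ∈ T := fun j hj => hT (by
    change (τ j ⇒ₚ .bot) ∈ SILogic.Box.carrier
    simp only [τ, if_neg hj.not_gt]
    exact SILogic.Box.ipc_mem _ (.exFalso _))
  -- For `w = T` nothing above `T` is excluded, so the map covers the whole frame above `T`.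
  obtain ⟨i, g, hmono, hback, himage⟩ := hbox.hasLadderMap (hbox.finite_setOf_le hneg) le_rfl
  obtain ⟨d, hd, rfl⟩ := (himage T).1 ⟨le_rfl, lt_irrefl _⟩
  refine hφT (forces_val_iff.1 ((forces_iff_of_bisimulation
    -- Levels beyond `i` carry no information about `g`; making all variables false there keeps the
    -- valuation persistent.
    (V' := fun p (e : Ladder) => e.level ≤ i ∧ Formula.var p ∈ g e)
    (fun u (e : Ladder) => e.level ≤ i ∧ g e = u) ?_ ?_ ?_ φ ⟨hd, rfl⟩).2 (hφ _ ?_ d)))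
  · rintro _ e ⟨he, rfl⟩ p
    exact ⟨fun h => ⟨he, h⟩, fun h => h.2⟩
  · rintro _ e ⟨he, rfl⟩ u hu
    obtain ⟨e', hee', rfl⟩ := hback e he u hu
    exact ⟨e', hee', (level_le hee').trans he, rfl⟩
  · rintro _ e ⟨he, rfl⟩ e' hee'
    exact ⟨g e', hmono e e' he hee', (level_le hee').trans he, rfl⟩
  · rintro p e e' hee' ⟨he, hp⟩
    exact ⟨(level_le hee').trans he, hmono e e' he hee' hp⟩

theorem mainTheorem2 : SILogic.IsPreUniformlyLocallyTabular SILogic.Box := by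
  refine ⟨Ladder.not_isUniformlyLocallyTabular_box, fun L hL => ?_⟩
  by_contra h
  exact hL.2 ((SILogic.subset_logicOf_ladder hL.1 h).trans Ladder.logicOf_subset_box)
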